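/- **Theorem (Completeness for one definition in the antecedent).** Let $D$ be an arbitrary (possibly non-total) definition and let $\Gamma,\Delta$ be finite sets of PC-formulas over a propositional vocabulary $\tau$. If the sequent $D,\Gamma\to\Delta$ is valid, then it is provable in the sequent calculus described below. *Formulas.* PC-formulas over $\tau$ are built from the atoms of $\tau$ and the constants $\bot,\top$ with $\neg,\wedge,\vee$. A definition $D$ over $\tau$ is a finite set of rules $P\leftarrow\varphi$ with $P\in\tau$ and $\varphi$ a PC-formula, with at most one rule $P\leftarrow\varphi_P$ for each atom $P$; the heads of rules are the defined atoms, forming the set $\mathrm{Def}(D)$, and all other atoms are open. PC(ID)-formulas are built from atoms, definitions, $\bot$ and $\top$ with $\neg,\wedge,\vee$. Write $A\equiv B$ for $(A\wedge B)\vee(\neg A\wedge\neg B)$. *Semantics.* A three-valued interpretation maps $\tau$ to $\{\mathbf f,\mathbf u,\mathbf t\}$; with $\mathbf f<\mathbf u<\mathbf t$, conjunction is minimum, disjunction is maximum, and negation exchanges $\mathbf f$ and $\mathbf t$ and fixes $\mathbf u$. It is two-valued if no atom is mapped to $\mathbf u$. Given a two-valued interpretation $I_O$ of the open atoms of $D$,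 a well-founded induction starts from the extension of $I_O$ that is $\mathbf u$ on $\mathrm{Def}(D)$ and proceeds by steps $I\mapsto I[P/\mathbf t]$, where $I(P)=\mathbf u$ and $\varphi^I=\mathbf t$ for some rule $P\leftarrow\varphi$ of $D$, or $I\mapsto I[U/\mathbf f]$, where $U\neq\emptyset$ is a set of defined atoms that are $\mathbf u$ in $I$ and $\varphi^{I[U/\mathbf f]}=\mathbf f$ for each rule $P\leftarrow\varphi$ of $D$ with $P\in U$. The limit of such a sequence that cannot be extended is the well-founded partial interpretation $I_O^D$. $D$ is true in $I$ if $I$ is two-valued and $I=(I|_{\text{open atoms}})^D$, and false otherwise; $D$ is total if $I_O^D$ is two-valued for every two-valued $I_O$. A sequent $\Gamma\to\Delta$ (with $\Gamma,\Delta$ finite sets of PC(ID)-formulas) is valid if every two-valued interpretation satisfying all of $\Gamma$ satisfies some element of $\Delta$. *Calculus.* The axioms are $\Gamma,A\to A,\Delta$; $\ \bot\to\Delta$; $\ \Gamma\to\top$. The structural and logical rules are left and right weakening, left and right contraction, cut (from $\Gamma\to\Delta,A$ and $A,\Gamma\to\Delta$ infer $\Gamma\to\Delta$), and the usual left and right sequent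 rules for $\neg,\wedge,\vee$ (with both subformulas together in the premise for $\wedge$-left and $\vee$-right). The definition rules are as follows; in each, the conclusion is over a vocabulary $\tau$ and the renamed atoms are new atoms added to $\tau$. 1. Right definition rule ($P\in\mathrm{Def}(D)$): from $\Gamma\to\Delta,\varphi_P$ infer $D,\Gamma\to\Delta,P$. 2. Left definition rule ($P\in U\subseteq\mathrm{Def}(D)$): from $\neg U^{\triangleright},\Gamma\to\Delta,\neg\varphi_Q^{\triangleright}$ for all $Q\in U$ infer $P,D,\Gamma\to\Delta$. Here $\neg U^\triangleright=\{\neg Q^\triangleright\mid Q\in U\}$, and $\varphi^{\triangleright}$ is $\varphi$ with each positive occurrence of each atom $Q\in U$ replaced by $Q^{\triangleright}$. 3. Non-total definition rule ($\emptyset\ne V\subseteq\mathrm{Def}(D)$): from $V^{\diamond},D^{\diamond},\Gamma\to\Delta,\bigwedge\neg V^{\triangleright}$ and $\neg V^{\diamond},D^{\diamond},\Gamma\to\Delta,\bigwedge V^{\triangleright}$ infer $D,\Gamma\to\Delta$. Here $V^\triangleright,V^\diamond$ are the sets of new atoms $P^\triangleright,P^\diamond$ for $P\in V$, $\neg V^\triangleright,\neg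 V^\diamond$ are the sets of their negations, and $D^{\diamond}=\{P^{\triangleright}\leftarrow\varphi_P^{\diamond}\mid P\in V\}$, where $\varphi^{\diamond}$ is $\varphi$ with the positive occurrences of each $P\in V$ replaced by $P^{\triangleright}$ and the negative ones by $P^{\diamond}$. 4. Definition introduction rule ($D$ total): from $D',\Gamma\to\Delta,P'\equiv P$ for all $P\in\mathrm{Def}(D)$ infer $\Gamma\to\Delta,D$. Here $D'$ is $D$ with each occurrence of each defined atom $P$ replaced by the new atom $P'$. A sequent is provable if it is the root of a finite tree of sequents whose leaves are axioms and in which each interior node follows from its children by one of the rules. -/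

import Mathlib

universe u v

namespace PCID

/-! ## Formulas and definitions -/

/-- PC-formulas over the vocabulary `α` (the type of its propositional atoms). The logical constants
`⊥` and `⊤` are included because the axioms of the proof system mention them. -/
inductive PCFormula (α : Type u) : Type u
  | atom : α → PCFormula α
  | bot : PCFormula α
  | top : PCFormula α
  | neg : PCFormula α → PCFormula α
  | and : PCFormula α → PCFormula α → PCFormula α
  | or : PCFormula α → PCFormula α → PCFormula α

/-- `φ.subst f g` replaces every positive occurrence of an atom `P` in `φ` by `f P` and every
negative occurrence by `g P`. -/
def PCFormula.subst {α : Type u} {β : Type v} : (α → β) → (α → β) → PCFormula α → PCFormula β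
  | f, _, .atom P => .atom (f P)
  | _, _, .bot => .bot
  | _, _, .top => .top
  | f, g, .neg φ => .neg (φ.subst g f)
  | f, g, .and φ ψ => .and (φ.subst f g) (ψ.subst f g)
  | f, g, .or φ ψ => .or (φ.subst f g) (ψ.subst f g)

/-- A definition over `α`: a finite set of rules `P ← φ`, written as pairs `(P, φ)`, with at most one
rule for each head. -/
structure Definition (α : Type u) : Type u where
  rules : Finset (α × PCFormula α)
  unique : ∀ P φ ψ, (P, φ) ∈ rules → (P, ψ) ∈ rules → φ = ψ

open Classical in
/-- The set of defined atoms (heads of rules); every other atom is open. -/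
noncomputable def Definition.defined {α : Type u} (D : Definition α) : Finset α :=
  D.rules.image Prod.fst

/-- PC(ID)-formulas over `α`. -/
inductive Formula (α : Type u) : Type u
  | atom : α → Formula α
  | defn : Definition α → Formula α
  | bot : Formula α
  | top : Formula α
  | neg : Formula α → Formula α
  | and : Formula α → Formula α → Formula α
  | or : Formula α → Formula α → Formula α

noncomputable instance {α : Type u} : DecidableEq (Formula α) := Classical.decEq _

/-- A PC-formula seen as a PC(ID)-formula. -/
def PCFormula.toFormula {α : Type u} : PCFormula α → Formula α
  | .atom P => .atom P
  | .bot => .bot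
  | .top => .top
  | .neg φ => .neg φ.toFormula
  | .and φ ψ => .and φ.toFormula ψ.toFormula
  | .or φ ψ => .or φ.toFormula ψ.toFormula

/-- `A ≡ B`, which abbreviates `(A ∧ B) ∨ (¬A ∧ ¬B)`. -/
def Formula.equiv {α : Type u} (A B : Formula α) : Formula α :=
  .or (.and A B) (.and (.neg A) (.neg B))

/-- The conjunction of a list of formulas. -/
def conj {α : Type u} : List (Formula α) → Formula α
  | [] => .top
  | [A] => A
  | A :: B :: l => .and A (conj (B :: l))

open Classical in
/-- The rules `f P ← φ.subst f g` for the rules `P ← φ` of `D` with `P ∈ V`. -/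
noncomputable def Definition.subst {α : Type u} {β : Type v} (D : Definition α) (V : Finset α)
    (f g : α → β) (hf : Function.Injective f) : Definition β where
  rules := (D.rules.filter (fun r => r.1 ∈ V)).image (fun r => (f r.1, r.2.subst f g))
  unique := by
    intro P φ ψ h₁ h₂
    simp only [Finset.mem_image, Finset.mem_filter, Prod.mk.injEq, Prod.exists] at h₁ h₂
    obtain ⟨a, χ, ⟨ha, -⟩, rfl, rfl⟩ := h₁
    obtain ⟨b, ξ, ⟨hb, -⟩, hab, rfl⟩ := h₂
    have hba : b = a := hf hab
    subst hba
    rw [D.unique b χ ξ ha hb]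

/-- The definition `D` over `α` seen over a larger vocabulary `β ⊇ α`. -/
noncomputable def Definition.map {α : Type u} {β : Type v} (e : α ↪ β) (D : Definition α) :
    Definition β :=
  D.subst D.defined e e e.injective

/-- A formula over `α` seen over a larger vocabulary `β ⊇ α`. -/
noncomputable def Formula.map {α : Type u} {β : Type v} (e : α ↪ β) : Formula α → Formula β
  | .atom P => .atom (e P)
  | .defn D => .defn (D.map e)
  | .bot => .bot
  | .top => .top
  | .neg A => .neg (A.map e)
  | .and A B => .and (A.map e) (B.map e)
  | .or A B => .or (A.map e) (B.map e)

/-- A finite set of formulas over `α` seen over `α` augmented with the new atoms `β`. -/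
noncomputable def lift {α : Type u} (β : Type u) (Γ : Finset (Formula α)) :
    Finset (Formula (α ⊕ β)) :=
  Γ.image (Formula.map Function.Embedding.inl)

/-! ## Three-valued and well-founded semantics -/

/-- The truth values false, unknown and true. -/
inductive TruthValue : Type
  | fa | un | tr

/-- Inverse: it exchanges false and true. -/
def TruthValue.inv : TruthValue → TruthValue
  | .fa => .tr
  | .un => .un
  | .tr => .fa

/-- Minimum in the truth order `fa ≤ un ≤ tr`. -/
def TruthValue.min : TruthValue → TruthValue → TruthValue
  | .fa, _ => .fa
  | _, .fa => .fa
  | .un, _ => .un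
  | _, .un => .un
  | .tr, .tr => .tr

/-- Maximum in the truth order `fa ≤ un ≤ tr`. -/
def TruthValue.max : TruthValue → TruthValue → TruthValue
  | .tr, _ => .tr
  | _, .tr => .tr
  | .un, _ => .un
  | _, .un => .un
  | .fa, .fa => .fa

/-- Three-valued interpretations of the vocabulary `α`. -/
abbrev Interp (α : Type u) : Type u := α → TruthValue

/-- No atom is unknown. -/
def Interp.TwoValued {α : Type u} (I : Interp α) : Prop := ∀ P, I P ≠ .un

open Classical in
/-- `I[U/v]`: the interpretation that assigns `v` to the atoms of `U` and agrees with `I`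
elsewhere. -/
noncomputable def Interp.assign {α : Type u} (I : Interp α) (U : Set α) (v : TruthValue) :
    Interp α :=
  fun P => if P ∈ U then v else I P

/-- The truth value of a PC-formula. -/
def PCFormula.val {α : Type u} (I : Interp α) : PCFormula α → TruthValue
  | .atom P => I P
  | .bot => .fa
  | .top => .tr
  | .neg φ => (φ.val I).inv
  | .and φ ψ => (φ.val I).min (ψ.val I)
  | .or φ ψ => (φ.val I).max (ψ.val I)

/-- One step of a well-founded induction for `D`. -/
inductive Definition.Step {α : Type u} (D : Definition α) : Interp α → Interp α → Prop
  | derive_true (I : Interp α) (P : α) (φ : PCFormula α) (hP : I P = .un)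
      (hr : (P, φ) ∈ D.rules) (hφ : φ.val I = .tr) :
      D.Step I (I.assign {P} .tr)
  | derive_false (I : Interp α) (U : Set α) (hne : U.Nonempty)
      (hU : ∀ P ∈ U, P ∈ D.defined ∧ I P = .un)
      (hφ : ∀ P ∈ U, ∀ φ, (P, φ) ∈ D.rules → φ.val (I.assign U .fa) = .fa) :
      D.Step I (I.assign U .fa)

/-- `I` is the well-founded partial interpretation of `D` extending the restriction of `I₀` to the
open atoms of `D`: the limit of a terminal well-founded induction, which starts from the
interpretation that agrees with `I₀` on the open atoms and is unknown on the defined atoms.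
Every step makes one of the finitely many defined atoms known, so each well-founded induction is
finite. -/
def Definition.IsWellFounded {α : Type u} (D : Definition α) (I₀ I : Interp α) : Prop :=
  Relation.ReflTransGen D.Step (I₀.assign (D.defined : Set α) .un) I ∧ ∀ J, ¬ D.Step I J

/-- `D` is true in `I`: `I` is two-valued and is the well-founded partial interpretation of `D`
extending its own restriction to the open atoms. -/
def Definition.Holds {α : Type u} (D : Definition α) (I : Interp α) : Prop :=
  I.TwoValued ∧ D.IsWellFounded I I

/-- `D` is total: for every two-valued interpretation of its open atoms, the well-founded partial
interpretation extending it is two-valued. -/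
def Definition.Total {α : Type u} (D : Definition α) : Prop :=
  ∀ I₀ : Interp α, (∀ P, P ∉ D.defined → I₀ P ≠ .un) → ∃ I, D.IsWellFounded I₀ I ∧ I.TwoValued

open Classical in
/-- The truth value of a PC(ID)-formula. -/
noncomputable def Formula.val {α : Type u} (I : Interp α) : Formula α → TruthValue
  | .atom P => I P
  | .defn D => if D.Holds I then .tr else .fa
  | .bot => .fa
  | .top => .tr
  | .neg A => (A.val I).inv
  | .and A B => (A.val I).min (B.val I)
  | .or A B => (A.val I).max (B.val I)

/-- `I ⊨ A`: `I` is two-valued and `A` is true in it. -/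
def Models {α : Type u} (I : Interp α) (A : Formula α) : Prop :=
  I.TwoValued ∧ A.val I = .tr

/-- The sequent `Γ → Δ` is valid: each (two-valued) interpretation satisfying all formulas of `Γ`
satisfies a formula of `Δ`. -/
def Valid {α : Type u} (Γ Δ : Finset (Formula α)) : Prop :=
  ∀ I : Interp α, I.TwoValued → (∀ A ∈ Γ, Models I A) → ∃ B ∈ Δ, Models I B

/-! ## Renamings used by the definition rules

The augmented vocabularies are the disjoint unions of the vocabulary with types of new atoms. -/

open Classical in
/-- `P ↦ P▷` for `P ∈ U`; the other atoms are unchanged. -/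
noncomputable def triAtom {α : Type u} (U : Finset α) (P : α) : α ⊕ U :=
  if h : P ∈ U then .inr ⟨P, h⟩ else .inl P

/-- `φ▷`: positive occurrences of the atoms `P ∈ U` become `P▷`. -/
noncomputable def PCFormula.tri {α : Type u} (U : Finset α) (φ : PCFormula α) :
    PCFormula (α ⊕ U) :=
  φ.subst (triAtom U) .inl

/-- `¬U▷ = {¬P▷ | P ∈ U}`. -/
noncomputable def negTri {α : Type u} (U : Finset α) : Finset (Formula (α ⊕ U)) :=
  U.attach.image (fun P => .neg (.atom (.inr P)))

open Classical in
/-- For the vocabulary with new atoms `P▷ = inr (inl P)` and `P◇ = inr (inr P)` for `P ∈ V`: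
the map `P ↦ P▷` for `P ∈ V`; the other atoms are unchanged. -/
noncomputable def diaPos {α : Type u} (V : Finset α) (P : α) : α ⊕ (V ⊕ V) :=
  if h : P ∈ V then .inr (.inl ⟨P, h⟩) else .inl P

open Classical in
/-- The map `P ↦ P◇` for `P ∈ V`; the other atoms are unchanged. -/
noncomputable def diaNeg {α : Type u} (V : Finset α) (P : α) : α ⊕ (V ⊕ V) :=
  if h : P ∈ V then .inr (.inr ⟨P, h⟩) else .inl P

theorem diaPos_injective {α : Type u} (V : Finset α) : Function.Injective (diaPos V) := by
  intro P Q h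
  unfold diaPos at h
  split_ifs at h <;> simp_all

theorem triAtom_injective {α : Type u} (U : Finset α) : Function.Injective (triAtom U) := by
  intro P Q h
  unfold triAtom at h
  split_ifs at h <;> simp_all

/-- `D◇ = {P▷ ← φ◇ | P ∈ V, (P ← φ) ∈ D}`, where `φ◇` is obtained from `φ` by replacing the positive
occurrences of each `P ∈ V` by `P▷` and the negative ones by `P◇`. -/
noncomputable def Definition.dia {α : Type u} (V : Finset α) (D : Definition α) :
    Definition (α ⊕ (V ⊕ V)) :=
  D.subst V (diaPos V) (diaNeg V) (diaPos_injective V)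

/-- `D'`: each occurrence of a defined atom `P` of `D` is replaced by a new atom `P'`. -/
noncomputable def Definition.prime {α : Type u} (D : Definition α) :
    Definition (α ⊕ D.defined) :=
  D.subst D.defined (triAtom D.defined) (triAtom D.defined) (triAtom_injective D.defined)

/-! ## The proof system -/

/-- `Provable Γ Δ`: there is a proof tree for the sequent `Γ → Δ`, where `Γ` and `Δ` are finite sets
of PC(ID)-formulas. The vocabulary `α` varies along the tree. -/
inductive Provable : ∀ {α : Type u}, Finset (Formula α) → Finset (Formula α) → Prop
  /- axioms -/
  | ax {α : Type u} (Γ Δ : Finset (Formula α)) (A : Formula α) :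
      Provable (insert A Γ) (insert A Δ)
  | ax_bot {α : Type u} (Δ : Finset (Formula α)) : Provable {Formula.bot} Δ
  | ax_top {α : Type u} (Γ : Finset (Formula α)) : Provable Γ {Formula.top}
  /- structural rules -/
  | weaken_left {α : Type u} (Γ Δ : Finset (Formula α)) (A : Formula α) :
      Provable Γ Δ → Provable (insert A Γ) Δ
  | weaken_right {α : Type u} (Γ Δ : Finset (Formula α)) (A : Formula α) :
      Provable Γ Δ → Provable Γ (insert A Δ)
  | contract_left {α : Type u} (Γ Δ : Finset (Formula α)) (A : Formula α) :
      Provable (insert A (insert A Γ)) Δ → Provable (insert A Γ) Δ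
  | contract_right {α : Type u} (Γ Δ : Finset (Formula α)) (A : Formula α) :
      Provable Γ (insert A (insert A Δ)) → Provable Γ (insert A Δ)
  | cut {α : Type u} (Γ Δ : Finset (Formula α)) (A : Formula α) :
      Provable Γ (insert A Δ) → Provable (insert A Γ) Δ → Provable Γ Δ
  /- logical rules -/
  | neg_left {α : Type u} (Γ Δ : Finset (Formula α)) (A : Formula α) :
      Provable Γ (insert A Δ) → Provable (insert (.neg A) Γ) Δ
  | neg_right {α : Type u} (Γ Δ : Finset (Formula α)) (A : Formula α) :
      Provable (insert A Γ) Δ → Provable Γ (insert (.neg A) Δ)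
  | and_left {α : Type u} (Γ Δ : Finset (Formula α)) (A B : Formula α) :
      Provable (insert A (insert B Γ)) Δ → Provable (insert (.and A B) Γ) Δ
  | and_right {α : Type u} (Γ Δ : Finset (Formula α)) (A B : Formula α) :
      Provable Γ (insert A Δ) → Provable Γ (insert B Δ) → Provable Γ (insert (.and A B) Δ)
  | or_left {α : Type u} (Γ Δ : Finset (Formula α)) (A B : Formula α) :
      Provable (insert A Γ) Δ → Provable (insert B Γ) Δ → Provable (insert (.or A B) Γ) Δ
  | or_right {α : Type u} (Γ Δ : Finset (Formula α)) (A B : Formula α) :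
      Provable Γ (insert A (insert B Δ)) → Provable Γ (insert (.or A B) Δ)
  /- right definition rule for `P` -/
  | def_right {α : Type u} (Γ Δ : Finset (Formula α)) (D : Definition α) (P : α)
      (φ : PCFormula α) (hr : (P, φ) ∈ D.rules) :
      Provable Γ (insert φ.toFormula Δ) →
      Provable (insert (.defn D) Γ) (insert (.atom P) Δ)
  /- left definition rule for `P ∈ U` -/
  | def_left {α : Type u} (Γ Δ : Finset (Formula α)) (D : Definition α) (U : Finset α)
      (hU : U ⊆ D.defined) (P : α) (hP : P ∈ U) :
      (∀ Q ∈ U, ∀ φ, (Q, φ) ∈ D.rules →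
        Provable (negTri U ∪ lift U Γ) (insert (.neg (φ.tri U).toFormula) (lift U Δ))) →
      Provable (insert (.atom P) (insert (.defn D) Γ)) Δ
  /- non-total definition rule -/
  | def_nontotal {α : Type u} (Γ Δ : Finset (Formula α)) (D : Definition α) (V : Finset α)
      (hV : V ⊆ D.defined) (hne : V.Nonempty) :
      Provable
        (V.attach.image (fun P => .atom (.inr (.inr P))) ∪
          insert (.defn (D.dia V)) (lift (V ⊕ V) Γ))
        (insert (conj (V.attach.toList.map (fun P => .neg (.atom (.inr (.inl P))))))
          (lift (V ⊕ V) Δ)) →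
      Provable
        (V.attach.image (fun P => .neg (.atom (.inr (.inr P)))) ∪
          insert (.defn (D.dia V)) (lift (V ⊕ V) Γ))
        (insert (conj (V.attach.toList.map (fun P => .atom (.inr (.inl P)))))
          (lift (V ⊕ V) Δ)) →
      Provable (insert (.defn D) Γ) Δ
  /- definition introduction rule -/
  | def_intro {α : Type u} (Γ Δ : Finset (Formula α)) (D : Definition α) (hD : D.Total) :
      (∀ P : D.defined,
        Provable (insert (.defn D.prime) (lift D.defined Γ))
          (insert (Formula.equiv (.atom (.inr P)) (.atom (.inl P.1))) (lift D.defined Δ))) →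
      Provable Γ (insert (.defn D) Δ)

end PCID

namespace PCID

/-! ## Structural lemmas -/

/-! Only finitely many atoms `S` occur in the sequent. Cutting on each of them
(`Provable.of_forall_literals`) reduces the claim to sequents whose antecedent also contains the
literals over `S` true in some two-valued `I`. Such literals decide every PC-formula over `S`, so
the sequent is provable at once if `I` falsifies some formula of `Γ` or satisfies some formula of
`Δ`. Otherwise validity forces `D` to be false in `I`, and what remains is `refutes_of_not_holds`:
the literals of `I` refute `D`.

To see this, run a well-founded induction from the open part of `I` for as long as it agrees with
`I`. If it makes an atom true that is false in `I`, the right definition rule contradicts the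
literals. If it makes a set `U` false that contains an atom true in `I`, the left definition rule
does. If it ends with no unknown atoms, its limit is `I` and `D` holds after all. If it ends with a
nonempty set `V` of unknown atoms, the non-total rule applies. There `D◇` computes `V▷` from a fixed
guess `V◇` for the negative occurrences: as no unknown atom is derivable, guessing all true makes
`V▷` all false; as no nonempty set of unknown atoms is unfounded, guessing all false makes `V▷` all
true.

The bridge between semantics and calculus is polarity. A three-valued value amounts to two
two-valued evaluations, in which unknown is read in opposite ways at positive and negative
occurrences (`PCFormula.val_eq_iff_holds`). The renamings in the definition rules separate the same
occurrences, so `PCFormula.proves_and_refutes` handles the rule bodies in all these premises. -/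

theorem Provable.mono {α : Type u} {Γ Γ' Δ Δ' : Finset (Formula α)} (h : Provable Γ Δ)
    (hΓ : Γ ⊆ Γ') (hΔ : Δ ⊆ Δ') : Provable Γ' Δ' := by
  have left : ∀ Θ : Finset (Formula α), Provable (Θ ∪ Γ) Δ := by
    intro Θ
    induction Θ using Finset.induction_on with
    | empty => simpa using h
    | insert A Θ _ ih => rw [Finset.insert_union]; exact .weaken_left _ _ _ ih
  have right : ∀ Θ : Finset (Formula α), Provable Γ' (Θ ∪ Δ) := by
    intro Θ
    induction Θ using Finset.induction_on with
    | empty => simpa [Finset.union_eq_left.2 hΓ] using left Γ'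
    | insert A Θ _ ih => rw [Finset.insert_union]; exact .weaken_right _ _ _ ih
  simpa [Finset.union_eq_left.2 hΔ] using right Δ'

theorem Provable.of_mem {α : Type u} {Γ Δ : Finset (Formula α)} (A : Formula α)
    (hΓ : A ∈ Γ) (hΔ : A ∈ Δ) : Provable Γ Δ := by
  have h := Provable.ax Γ Δ A
  rwa [Finset.insert_eq_of_mem hΓ, Finset.insert_eq_of_mem hΔ] at h

/-- `Γ` proves `A`. -/
abbrev Proves {α : Type u} (Γ : Finset (Formula α)) (A : Formula α) : Prop :=
  Provable Γ {A}

/-- `Γ` refutes `A`. -/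
abbrev Refutes {α : Type u} (Γ : Finset (Formula α)) (A : Formula α) : Prop :=
  Provable (insert A Γ) ∅

theorem Refutes.of_neg_mem {α : Type u} {Γ : Finset (Formula α)} {A : Formula α}
    (h : Formula.neg A ∈ Γ) : Refutes Γ A := by
  have := Provable.neg_left (insert A Γ) ∅ A (.of_mem A (by simp) (by simp))
  rwa [Finset.insert_eq_of_mem (Finset.mem_insert_of_mem h)] at this

theorem Proves.conj {α : Type u} {Γ : Finset (Formula α)} :
    ∀ l : List (Formula α), (∀ A ∈ l, Proves Γ A) → Proves Γ (PCID.conj l)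
  | [], _ => .ax_top Γ
  | [A], h => h A (by simp)
  | A :: B :: l, h => by
    have h₁ : Proves Γ A := h A (by simp)
    have h₂ : Proves Γ (PCID.conj (B :: l)) :=
      Proves.conj (B :: l) (fun C hC => h C (List.mem_cons_of_mem _ hC))
    exact Provable.and_right Γ ∅ A _ h₁ h₂

/-! ## Polarised evaluation -/

/-- The atoms occurring in a formula. -/
noncomputable def PCFormula.atoms {α : Type u} : PCFormula α → Set α
  | .atom P => {P}
  | .bot => ∅
  | .top => ∅
  | .neg φ => φ.atoms
  | .and φ ψ => φ.atoms ∪ ψ.atoms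
  | .or φ ψ => φ.atoms ∪ ψ.atoms

theorem PCFormula.atoms_finite {α : Type u} (φ : PCFormula α) : φ.atoms.Finite := by
  induction φ with
  | atom P => exact Set.finite_singleton P
  | bot => exact Set.finite_empty
  | top => exact Set.finite_empty
  | neg φ ih => exact ih
  | and φ ψ ih₁ ih₂ => exact ih₁.union ih₂
  | or φ ψ ih₁ ih₂ => exact ih₁.union ih₂

/-- Two-valued evaluation of a formula whose positive atoms are evaluated by `p` and whose negative
atoms are evaluated by `n`. -/
def PCFormula.Holds {α : Type u} : (α → Prop) → (α → Prop) → PCFormula α → Prop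
  | p, _, .atom P => p P
  | _, _, .bot => False
  | _, _, .top => True
  | p, n, .neg φ => ¬ φ.Holds n p
  | p, n, .and φ ψ => φ.Holds p n ∧ ψ.Holds p n
  | p, n, .or φ ψ => φ.Holds p n ∨ ψ.Holds p n

theorem TruthValue.inv_eq_tr (a : TruthValue) : a.inv = .tr ↔ a = .fa := by
  cases a <;> simp [TruthValue.inv]

theorem TruthValue.inv_eq_fa (a : TruthValue) : a.inv = .fa ↔ a = .tr := by
  cases a <;> simp [TruthValue.inv]

theorem TruthValue.min_eq_tr (a b : TruthValue) : a.min b = .tr ↔ a = .tr ∧ b = .tr := by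
  cases a <;> cases b <;> simp [TruthValue.min]

theorem TruthValue.min_eq_fa (a b : TruthValue) : a.min b = .fa ↔ a = .fa ∨ b = .fa := by
  cases a <;> cases b <;> simp [TruthValue.min]

theorem TruthValue.max_eq_tr (a b : TruthValue) : a.max b = .tr ↔ a = .tr ∨ b = .tr := by
  cases a <;> cases b <;> simp [TruthValue.max]

theorem TruthValue.max_eq_fa (a b : TruthValue) : a.max b = .fa ↔ a = .fa ∧ b = .fa := by
  cases a <;> cases b <;> simp [TruthValue.max]

/-- The truth value of a formula is the pair of its lower and upper two-valued evaluations. -/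
theorem PCFormula.val_eq_iff_holds {α : Type u} (W : Interp α) (φ : PCFormula α) :
    (φ.val W = .tr ↔ φ.Holds (fun P => W P = .tr) (fun P => W P ≠ .fa)) ∧
      (φ.val W = .fa ↔ ¬ φ.Holds (fun P => W P ≠ .fa) (fun P => W P = .tr)) := by
  induction φ with
  | atom P => simp [PCFormula.val, PCFormula.Holds]
  | bot => simp [PCFormula.val, PCFormula.Holds]
  | top => simp [PCFormula.val, PCFormula.Holds]
  | neg φ ih =>
    simp only [PCFormula.val, PCFormula.Holds, TruthValue.inv_eq_tr, TruthValue.inv_eq_fa]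
    tauto
  | and φ ψ ih₁ ih₂ =>
    simp only [PCFormula.val, PCFormula.Holds, TruthValue.min_eq_tr, TruthValue.min_eq_fa]
    tauto
  | or φ ψ ih₁ ih₂ =>
    simp only [PCFormula.val, PCFormula.Holds, TruthValue.max_eq_tr, TruthValue.max_eq_fa]
    tauto

/-- Renaming atoms does not change polarities, so renamings compose separately on each polarity.
This fuses the ◇-renaming of a body in `D◇` with the ▷-renaming that the left definition rule then
applies to it. -/
theorem PCFormula.subst_subst {α : Type u} {β : Type v} {γ : Type*} (φ : PCFormula α)
    (f g : α → β) (h k : β → γ) :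
    (φ.subst f g).subst h k = φ.subst (h ∘ f) (k ∘ g) := by
  induction φ generalizing f g h k <;> simp_all [PCFormula.subst]

theorem PCFormula.subst_id {α : Type u} (φ : PCFormula α) : φ.subst id id = φ := by
  induction φ <;> simp_all [PCFormula.subst]

theorem PCFormula.val_toFormula {α : Type u} (I : Interp α) (φ : PCFormula α) :
    φ.toFormula.val I = φ.val I := by
  induction φ <;> simp_all [PCFormula.toFormula, PCFormula.val, Formula.val]

/-- A context deciding the renamed atoms of `φ` according to a polarised evaluation proves or
refutes the renamed formula. -/
theorem PCFormula.proves_and_refutes {α : Type u} {β : Type u} (Γ : Finset (Formula β))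
    (φ : PCFormula α) (f g : α → β) (p n : α → Prop) :
    ((∀ P ∈ φ.atoms, p P → Formula.atom (f P) ∈ Γ) →
      (∀ P ∈ φ.atoms, ¬ n P → Formula.neg (.atom (g P)) ∈ Γ) →
      φ.Holds p n → Proves Γ (φ.subst f g).toFormula) ∧
    ((∀ P ∈ φ.atoms, ¬ p P → Formula.neg (.atom (f P)) ∈ Γ) →
      (∀ P ∈ φ.atoms, n P → Formula.atom (g P) ∈ Γ) →
      ¬ φ.Holds p n → Refutes Γ (φ.subst f g).toFormula) := by
  -- Negation exchanges proving with refuting as well as the two polarities, so both halves must be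
  -- proved together and for all renamings and evaluations.
  induction φ generalizing f g p n with
  | atom P =>
    exact ⟨fun h₁ _ h => .of_mem _ (h₁ P rfl h) (by simp [PCFormula.subst, PCFormula.toFormula]),
      fun h₁ _ h => .of_neg_mem (h₁ P rfl h)⟩
  | bot =>
    exact ⟨fun _ _ h => h.elim, fun _ _ _ => (Provable.ax_bot ∅).mono
      (by simp [PCFormula.subst, PCFormula.toFormula]) le_rfl⟩
  | top => exact ⟨fun _ _ _ => .ax_top Γ, fun _ _ h => (h trivial).elim⟩
  | neg φ ih =>
    refine ⟨fun h₁ h₂ h => ?_, fun h₁ h₂ h => ?_⟩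
    · exact Provable.neg_right Γ ∅ _ ((ih g f n p).2 h₂ h₁ h)
    · exact Provable.neg_left Γ ∅ _ ((ih g f n p).1 h₂ h₁ (not_not.1 h))
  | and φ ψ ih₁ ih₂ =>
    refine ⟨fun h₁ h₂ h => ?_, fun h₁ h₂ h => ?_⟩
    · exact Provable.and_right Γ ∅ _ _
        ((ih₁ f g p n).1 (fun P hP => h₁ P (.inl hP)) (fun P hP => h₂ P (.inl hP)) h.1)
        ((ih₂ f g p n).1 (fun P hP => h₁ P (.inr hP)) (fun P hP => h₂ P (.inr hP)) h.2)
    · refine Provable.and_left Γ ∅ _ _ ?_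
      rcases not_and_or.1 h with h | h
      · exact ((ih₁ f g p n).2 (fun P hP => h₁ P (.inl hP)) (fun P hP => h₂ P (.inl hP)) h).mono
          (Finset.insert_subset_insert _ (Finset.subset_insert _ _)) le_rfl
      · exact ((ih₂ f g p n).2 (fun P hP => h₁ P (.inr hP)) (fun P hP => h₂ P (.inr hP)) h).mono
          (Finset.subset_insert _ _) le_rfl
  | or φ ψ ih₁ ih₂ =>
    refine ⟨fun h₁ h₂ h => ?_, fun h₁ h₂ h => ?_⟩
    · refine Provable.or_right Γ ∅ _ _ ?_
      rcases h with h | h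
      · exact ((ih₁ f g p n).1 (fun P hP => h₁ P (.inl hP)) (fun P hP => h₂ P (.inl hP)) h).mono
          le_rfl (by simp)
      · exact ((ih₂ f g p n).1 (fun P hP => h₁ P (.inr hP)) (fun P hP => h₂ P (.inr hP)) h).mono
          le_rfl (by simp)
    · exact Provable.or_left Γ ∅ _ _
        ((ih₁ f g p n).2 (fun P hP => h₁ P (.inl hP)) (fun P hP => h₂ P (.inl hP))
          (fun h' => h (.inl h')))
        ((ih₂ f g p n).2 (fun P hP => h₁ P (.inr hP)) (fun P hP => h₂ P (.inr hP))
          (fun h' => h (.inr h')))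

/-! ## Literals of an interpretation -/

open Classical in
/-- The literal over `P` that is true in the two-valued interpretation `I`. -/
noncomputable def literal {α : Type u} (I : Interp α) (P : α) : Formula α :=
  if I P = .tr then .atom P else .neg (.atom P)

/-- The literals over the atoms in `S` that are true in the two-valued interpretation `I`. -/
noncomputable def literals {α : Type u} (I : Interp α) (S : Finset α) : Finset (Formula α) :=
  S.image (literal I)

section Literals

variable {α : Type u} {I : Interp α} {S : Finset α} {P : α}

theorem atom_mem_literals (hS : P ∈ S) (h : I P = .tr) : Formula.atom P ∈ literals I S :=
  Finset.mem_image.2 ⟨P, hS, by simp [literal, h]⟩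

theorem neg_atom_mem_literals (hS : P ∈ S) (h : I P ≠ .tr) :
    Formula.neg (.atom P) ∈ literals I S :=
  Finset.mem_image.2 ⟨P, hS, by simp [literal, h]⟩

theorem atom_mem_lift {β : Type u} {Γ : Finset (Formula α)} (h : Formula.atom P ∈ Γ) :
    Formula.atom (Sum.inl P) ∈ lift β Γ :=
  Finset.mem_image.2 ⟨_, h, rfl⟩

theorem neg_atom_mem_lift {β : Type u} {Γ : Finset (Formula α)}
    (h : Formula.neg (.atom P) ∈ Γ) : Formula.neg (.atom (Sum.inl P)) ∈ lift β Γ :=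
  Finset.mem_image.2 ⟨_, h, rfl⟩

end Literals

/-- Case distinction on all interpretations of finitely many atoms. -/
theorem Provable.of_forall_literals {α : Type u} (S : Finset α) {Γ Δ : Finset (Formula α)}
    (h : ∀ I : Interp α, I.TwoValued → Provable (literals I S ∪ Γ) Δ) : Provable Γ Δ := by
  classical
  induction S using Finset.induction_on with
  -- With no atoms to decide, any two-valued interpretation will do.
  | empty => simpa [literals] using h (fun _ => .tr) (fun _ => by simp)
  | insert a S ha ih =>
    refine ih fun I hI => ?_
    have key : ∀ v : TruthValue, v ≠ .un →
        Provable (insert (literal (fun _ => v) a) (literals I S ∪ Γ)) Δ := by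
      intro v hv
      have hJ : Interp.TwoValued (Function.update I a v) := by
        intro P
        by_cases hP : P = a
        · subst hP; simpa using hv
        · simpa [hP] using hI P
      have hJ' := h _ hJ
      have : literals (Function.update I a v) (insert a S)
          = insert (literal (fun _ => v) a) (literals I S) := by
        unfold literals
        rw [Finset.image_insert]
        congr 1
        · simp [literal]
        · refine Finset.image_congr fun P hP => ?_
          have : P ≠ a := fun h => ha (h ▸ hP)
          simp [literal, this]
      rwa [this, Finset.insert_union] at hJ'
    have h₁ := key .tr (by simp)
    have h₂ := key .fa (by simp)
    simp only [literal, if_true, reduceCtorEq, if_false] at h₁ h₂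
    -- Excluded middle for `a`: after the cuts on `a` and `¬a`, the remaining premise has both on
    -- the right.
    refine .cut _ _ (.atom a) ?_ h₁
    refine .cut _ _ (.neg (.atom a)) ?_ (h₂.mono le_rfl (Finset.subset_insert _ _))
    exact .neg_right _ _ _ (.of_mem (.atom a) (by simp) (by simp))

/-! ## Refuting a definition -/

section Refute

variable {α : Type u} {D : Definition α} {I W : Interp α} {S : Finset α}

theorem Definition.mem_defined {P : α} {φ : PCFormula α} (h : (P, φ) ∈ D.rules) :
    P ∈ D.defined := by
  classical
  exact Finset.mem_image.2 ⟨_, h, rfl⟩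

/-- A derivation of an atom from facts of `I` refutes the definition in `I` if the atom is false. -/
theorem refutes_of_derive_true (hD : ∀ P φ, (P, φ) ∈ D.rules → P ∈ S ∧ φ.atoms ⊆ S)
    (hWI : ∀ P, W P ≠ .un → W P = I P) {P : α} {φ : PCFormula α} (hr : (P, φ) ∈ D.rules)
    (hφ : φ.val W = .tr) (hP : I P ≠ .tr) : Refutes (literals I S) (.defn D) := by
  have hS := hD P φ hr
  have h : Proves (literals I S) φ.toFormula := by
    have := (φ.proves_and_refutes (literals I S) id id (fun P => W P = .tr)
      (fun P => W P ≠ .fa)).1 ?_ ?_ ((φ.val_eq_iff_holds W).1.1 hφ)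
    · rwa [PCFormula.subst_id] at this
    · intro Q hQ h
      exact atom_mem_literals (P := Q) (hS.2 hQ) (by rw [← hWI Q (by simp [h]), h])
    · intro Q hQ h
      have h := not_not.1 h
      exact neg_atom_mem_literals (P := Q) (hS.2 hQ) (by simp [← hWI Q (by simp [h]), h])
  -- The rule yields `P` from `D`, while `¬P` is among the literals of `I`.
  have h₁ := Provable.def_right _ ∅ D P φ hr h
  refine .cut _ _ (.atom P) h₁ (Refutes.of_neg_mem ?_)
  exact Finset.mem_insert_of_mem (neg_atom_mem_literals hS.1 hP)

open Classical in
/-- A set that is unfounded given facts of `I` refutes the definition in `I` if one of its atoms is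
true. -/
theorem refutes_of_derive_false (hD : ∀ P φ, (P, φ) ∈ D.rules → P ∈ S ∧ φ.atoms ⊆ S)
    (hWI : ∀ P, W P ≠ .un → W P = I P) {U : Set α} (hU : ∀ P ∈ U, P ∈ D.defined)
    (hφ : ∀ P ∈ U, ∀ φ, (P, φ) ∈ D.rules → φ.val (W.assign U .fa) = .fa)
    {P : α} (hPU : P ∈ U) (hPS : P ∈ S) (hP : I P = .tr) :
    Refutes (literals I S) (.defn D) := by
  -- The left definition rule needs a finite set; `T` has the same elements as `U`, which consists
  -- of defined atoms.
  set T : Finset α := D.defined.filter (· ∈ U) with hT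
  have hmem : ∀ Q, Q ∈ T ↔ Q ∈ U := fun Q => by
    simpa [hT] using hU Q
  have h := Provable.def_left (literals I S) ∅ D T (Finset.filter_subset _ _) P ((hmem P).2 hPU) ?_
  · rwa [Finset.insert_eq_of_mem
      (Finset.mem_insert_of_mem (atom_mem_literals hPS hP))] at h
  intro Q hQ φ hr
  have hS := hD Q φ hr
  refine Provable.neg_right _ _ _ ?_
  -- The body is false in `W[U/f]`, so its upper evaluation fails. The false positive atoms are
  -- those in `U`, covered by `¬U▷`, and those false in `W`. Negative occurrences are not renamed,
  -- but those needed are true in `W[U/f]`, hence lie outside `U` and are literals of `I`.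
  refine (φ.proves_and_refutes (negTri T ∪ lift T (literals I S)) (triAtom T) Sum.inl
    (fun P => W.assign U .fa P ≠ .fa) (fun P => W.assign U .fa P = .tr)).2 ?_ ?_
    ((φ.val_eq_iff_holds _).2.1 (hφ Q ((hmem Q).1 hQ) φ hr))
  · intro R hR h
    have h := not_not.1 h
    by_cases hRU : R ∈ U
    · have hRT := (hmem R).2 hRU
      refine Finset.mem_union_left _ ?_
      simp [negTri, triAtom, hRT]
    · have hRT : R ∉ T := fun h => hRU ((hmem R).1 h)
      simp only [Interp.assign, hRU, if_false] at h
      refine Finset.mem_union_right _ ?_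
      simp only [triAtom, hRT, dif_neg, not_false_eq_true]
      exact neg_atom_mem_lift
        (neg_atom_mem_literals (hS.2 hR) (by simp [← hWI R (by simp [h]), h]))
  · intro R hR h
    have hRU : R ∉ U := fun hRU => by simp [Interp.assign, hRU] at h
    simp only [Interp.assign, hRU, if_false] at h
    exact Finset.mem_union_right _
      (atom_mem_lift (atom_mem_literals (hS.2 hR) (by rw [← hWI R (by simp [h]), h])))

/-! ### Inductions that end with unknown atoms -/

theorem Definition.mem_dia_rules {V : Finset α} {Q : α ⊕ (V ⊕ V)} {ψ : PCFormula (α ⊕ (V ⊕ V))} :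
    (Q, ψ) ∈ (D.dia V).rules ↔
      ∃ P φ, (P, φ) ∈ D.rules ∧ P ∈ V ∧ diaPos V P = Q ∧
        φ.subst (diaPos V) (diaNeg V) = ψ := by
  classical
  simp [Definition.dia, Definition.subst, and_assoc]

/-- If no atom of `V` can be derived, then `D◇` makes all atoms of `V▷` false when the atoms of
`V◇` are true. -/
theorem refutes_tri_of_dia (hD : ∀ P φ, (P, φ) ∈ D.rules → P ∈ S ∧ φ.atoms ⊆ S)
    (hWI : ∀ P, W P ≠ .un → W P = I P) {V : Finset α} (hV : V ⊆ D.defined)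
    (hVW : ∀ P, P ∈ V ↔ W P = .un)
    (hφ : ∀ P ∈ V, ∀ φ, (P, φ) ∈ D.rules → φ.val W ≠ .tr) (P : V) :
    Refutes (V.attach.image (fun P => Formula.atom (.inr (.inr P))) ∪
          insert (.defn (D.dia V)) (lift (V ⊕ V) (literals I S))) (.atom (.inr (.inl P))) := by
  classical
  set Θ : Finset (Formula (α ⊕ (V ⊕ V))) :=
    V.attach.image (fun P => Formula.atom (.inr (.inr P))) ∪ lift (V ⊕ V) (literals I S) with hΘ
  -- The whole of `V▷` serves as the unfounded set of `D◇`.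
  set U : Finset (α ⊕ (V ⊕ V)) := V.image (diaPos V) with hU
  have hUD : U ⊆ (D.dia V).defined := by
    intro Q hQ
    obtain ⟨R, hR, rfl⟩ := Finset.mem_image.1 hQ
    obtain ⟨⟨R', φ⟩, hr, rfl⟩ := Finset.mem_image.1 (hV hR)
    exact Definition.mem_defined (Definition.mem_dia_rules.2 ⟨R', φ, hr, hR, rfl, rfl⟩)
  have hPU : Sum.inr (Sum.inl P) ∈ U :=
    Finset.mem_image.2 ⟨P, P.2, by simp [diaPos]⟩
  have h := Provable.def_left Θ ∅ (D.dia V) U hUD _ hPU ?_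
  · exact h.mono (by intro A; simp only [hΘ, Finset.mem_insert, Finset.mem_union]; tauto) le_rfl
  intro Q hQ ψ hψ
  obtain ⟨R, φ, hr, hR, rfl, rfl⟩ := Definition.mem_dia_rules.1 hψ
  have hS := hD R φ hr
  refine Provable.neg_right _ _ _ ?_
  rw [PCFormula.tri, PCFormula.subst_subst]
  -- The body is not true in `W`, so its lower evaluation fails. That evaluation counts unknown
  -- atoms as false at positive occurrences, matching `¬U▷`, and as true at negative ones, matching
  -- the hypotheses `V◇`.
  refine (φ.proves_and_refutes (negTri U ∪ lift U Θ) _ _ (fun P => W P = .tr)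
    (fun P => W P ≠ .fa)).2 ?_ ?_ (fun h => hφ R hR φ hr ((φ.val_eq_iff_holds W).1.2 h))
  · intro X hX h
    by_cases hXV : X ∈ V
    · have hXU : diaPos V X ∈ U := Finset.mem_image_of_mem _ hXV
      refine Finset.mem_union_left _ ?_
      simp [negTri, triAtom, hXU]
    · have hXU : diaPos V X ∉ U := fun h' => by
        obtain ⟨Y, hY, hYX⟩ := Finset.mem_image.1 h'
        exact hXV (diaPos_injective V hYX ▸ hY)
      refine Finset.mem_union_right _ ?_
      rw [Function.comp, triAtom, dif_neg hXU, diaPos, dif_neg hXV]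
      refine neg_atom_mem_lift (Finset.mem_union_right _ (neg_atom_mem_lift
        (neg_atom_mem_literals (hS.2 hX) ?_)))
      rwa [← hWI X (fun h' => hXV ((hVW X).2 h'))]
  · intro X hX h
    refine Finset.mem_union_right _ (atom_mem_lift ?_)
    by_cases hXV : X ∈ V
    · refine Finset.mem_union_left _ ?_
      simp [diaNeg, hXV]
    · refine Finset.mem_union_right _ ?_
      simp only [diaNeg, hXV, dif_neg, not_false_eq_true]
      have hun : W X ≠ .un := fun h' => hXV ((hVW X).2 h')
      refine atom_mem_lift (atom_mem_literals (hS.2 hX) ?_)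
      rw [← hWI X hun]
      cases hv : W X <;> simp_all

/-- If no nonempty subset of `V` is unfounded, then `D◇` makes all atoms of `V▷` true when the atoms
of `V◇` are false. -/
theorem proves_tri_of_dia (hD : ∀ P φ, (P, φ) ∈ D.rules → P ∈ S ∧ φ.atoms ⊆ S)
    (hWI : ∀ P, W P ≠ .un → W P = I P) {V : Finset α}
    (hVW : ∀ P, P ∈ V ↔ W P = .un)
    (hφ : ∀ U : Finset α, U.Nonempty → U ⊆ V →
      ∃ P ∈ U, ∃ φ, (P, φ) ∈ D.rules ∧ φ.val (W.assign U .fa) ≠ .fa) (P : V) :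
    Proves (V.attach.image (fun P => Formula.neg (.atom (.inr (.inr P)))) ∪
          insert (.defn (D.dia V)) (lift (V ⊕ V) (literals I S))) (.atom (.inr (.inl P))) := by
  classical
  set Θ : Finset (Formula (α ⊕ (V ⊕ V))) :=
    V.attach.image (fun P => Formula.neg (.atom (.inr (.inr P)))) ∪
          insert (.defn (D.dia V)) (lift (V ⊕ V) (literals I S)) with hΘ
  -- `U` is the set of atoms whose ▷-copies are not yet derived; the others are already hypotheses.
  -- Since `U` is not unfounded, some `Q ∈ U` has a body that is not false in `W[U/f]`. The right
  -- definition rule for `D◇` derives its copy, and a cut removes `Q` from `U`.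
  suffices H : ∀ k, ∀ U : Finset α, U.card = k → U ⊆ V →
      Proves ((V \ U).image (fun P => Formula.atom (diaPos V P)) ∪ Θ)
        (.atom (.inr (.inl P))) by
    simpa using H _ V rfl le_rfl
  intro k
  induction k with
  | zero =>
    intro U hU _
    obtain rfl := Finset.card_eq_zero.1 hU
    refine .of_mem _ (Finset.mem_union_left _ ?_) (Finset.mem_singleton_self _)
    exact Finset.mem_image.2 ⟨P, by simp, by simp [diaPos]⟩
  | succ k ih =>
    intro U hU hUV
    obtain ⟨Q, hQ, φ, hr, hval⟩ := hφ U (Finset.card_pos.1 (by omega)) hUV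
    have hS := hD Q φ hr
    have h₂ := ih (U.erase Q) (by rw [Finset.card_erase_of_mem hQ]; omega)
      ((Finset.erase_subset _ _).trans hUV)
    have hsub : (V \ U.erase Q).image (fun P => Formula.atom (diaPos V P)) ⊆
        insert (.atom (diaPos V Q)) ((V \ U).image (fun P => Formula.atom (diaPos V P))) := by
      rw [← Finset.image_insert (fun P => Formula.atom (diaPos V P))]
      refine Finset.image_subset_image ?_
      intro X
      simp only [Finset.mem_sdiff, Finset.mem_erase, Finset.mem_insert]
      tauto
    refine .cut _ _ (.atom (diaPos V Q)) ?_
      (h₂.mono (by rw [← Finset.insert_union]; exact Finset.union_subset_union_left hsub) le_rfl)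
    have h₁ := Provable.def_right ((V \ U).image (fun P => Formula.atom (diaPos V P)) ∪ Θ) ∅
      (D.dia V) (diaPos V Q) (φ.subst (diaPos V) (diaNeg V))
      (Definition.mem_dia_rules.2 ⟨Q, φ, hr, hUV hQ, rfl, rfl⟩) ?_
    · exact h₁.mono (by simp [hΘ]) (by simp)
    -- The upper evaluation in `W[U/f]` counts an unknown atom at a positive occurrence as true
    -- exactly when it is outside `U`, that is, already derived. At negative occurrences all of `V`
    -- counts as false, matching `¬V◇`.
    refine (φ.proves_and_refutes _ _ _ (fun P => W.assign U .fa P ≠ .fa)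
      (fun P => W.assign U .fa P = .tr)).1 ?_ ?_
      (by_contra fun h => hval ((φ.val_eq_iff_holds _).2.2 h))
    · intro X hX h
      have hXU : X ∉ U := fun h' => by simp [Interp.assign, h'] at h
      simp only [Interp.assign, Finset.mem_coe, hXU, if_false] at h
      by_cases hXV : X ∈ V
      · refine Finset.mem_union_left _ ?_
        exact Finset.mem_image.2 ⟨X, by simp [hXV, hXU], rfl⟩
      · refine Finset.mem_union_right _ (Finset.mem_union_right _ (Finset.mem_insert_of_mem ?_))
        simp only [diaPos, hXV, dif_neg, not_false_eq_true]
        have hun : W X ≠ .un := fun h' => hXV ((hVW X).2 h')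
        refine atom_mem_lift (atom_mem_literals (hS.2 hX) ?_)
        rw [← hWI X hun]
        cases hv : W X <;> simp_all
    · intro X hX h
      refine Finset.mem_union_right _ ?_
      by_cases hXV : X ∈ V
      · refine Finset.mem_union_left _ ?_
        simp [diaNeg, hXV]
      · refine Finset.mem_union_right _ (Finset.mem_insert_of_mem ?_)
        have hXU : X ∉ U := fun h' => hXV (hUV h')
        simp only [Interp.assign, Finset.mem_coe, hXU, if_false] at h
        simp only [diaNeg, hXV, dif_neg, not_false_eq_true]
        refine neg_atom_mem_lift (neg_atom_mem_literals (hS.2 hX) ?_)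
        rwa [← hWI X (fun h' => hXV ((hVW X).2 h'))]

open Classical in
/-- A well-founded induction that ends with unknown atoms refutes the definition. -/
theorem refutes_of_terminal (hD : ∀ P φ, (P, φ) ∈ D.rules → P ∈ S ∧ φ.atoms ⊆ S)
    (hWI : ∀ P, W P ≠ .un → W P = I P) (hun : ∀ P, W P = .un → P ∈ D.defined)
    (hW : ∀ J, ¬ D.Step W J) {P : α} (hP : W P = .un) : Refutes (literals I S) (.defn D) := by
  set V : Finset α := D.defined.filter (fun P => W P = .un) with hV
  have hVW : ∀ P, P ∈ V ↔ W P = .un := fun P => by simpa [hV] using hun P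
  have hsub : V ⊆ D.defined := Finset.filter_subset _ _
  -- The first premise uses that no `derive_true` step is possible, the second that no
  -- `derive_false` step is.
  refine Provable.def_nontotal (literals I S) ∅ D V hsub ⟨P, (hVW P).2 hP⟩ ?_ ?_
  · refine Proves.conj _ fun A hA => ?_
    obtain ⟨Q, -, rfl⟩ := List.mem_map.1 hA
    refine Provable.neg_right _ ∅ _ (refutes_tri_of_dia hD hWI hsub hVW ?_ Q)
    intro R hR φ hr hφ
    exact hW _ (.derive_true W R φ ((hVW R).1 hR) hr hφ)
  · refine Proves.conj _ fun A hA => ?_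
    obtain ⟨Q, -, rfl⟩ := List.mem_map.1 hA
    refine proves_tri_of_dia hD hWI hVW ?_ Q
    intro U hne hUV
    by_contra! h
    exact hW _ (.derive_false W U hne (fun R hR => ⟨hsub (hUV hR), (hVW R).1 (hUV hR)⟩)
      fun R hR φ hr => h R hR φ hr)

open Classical in
/-- A definition that is false in a two-valued interpretation is refuted by its literals. -/
theorem refutes_of_not_holds (hD : ∀ P φ, (P, φ) ∈ D.rules → P ∈ S ∧ φ.atoms ⊆ S)
    (hI : I.TwoValued) (hDI : ¬ D.Holds I) : Refutes (literals I S) (.defn D) := by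
  -- The invariant of the simulated induction: `W` is reachable, agrees with `I` wherever it is
  -- known, and is unknown only at defined atoms. The number of unknown atoms decreases; strong
  -- induction is needed because one step may falsify many atoms.
  suffices H : ∀ k, ∀ W : Interp α, (D.defined.filter (fun P => W P = .un)).card = k →
      Relation.ReflTransGen D.Step (I.assign (D.defined : Set α) .un) W →
      (∀ P, W P ≠ .un → W P = I P) → (∀ P, W P = .un → P ∈ D.defined) →
      Refutes (literals I S) (.defn D) by
    refine H _ _ rfl .refl ?_ ?_
    · intro P h
      by_cases hP : P ∈ D.defined <;> simp_all [Interp.assign]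
    · intro P h
      by_contra hP
      exact hI P (by simpa [Interp.assign, hP] using h)
  intro k
  induction k using Nat.strong_induction_on with
  | _ k ih =>
    intro W hk hreach hWI hun
    -- A step that agrees with `I` preserves the invariant, so the simulation continues from its
    -- result.
    have next : ∀ (U : Set α) (v : TruthValue), v ≠ .un → U.Nonempty → (∀ P ∈ U, W P = .un) →
        D.Step W (W.assign U v) → (∀ P ∈ U, I P = v) → Refutes (literals I S) (.defn D) := by
      intro U v hv hne hU hstep hUI
      refine ih _ ?_ (W.assign U v) rfl (hreach.tail hstep) ?_ ?_
      · rw [← hk]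
        obtain ⟨Q, hQU⟩ := hne
        refine Finset.card_lt_card (Finset.ssubset_iff_of_subset ?_ |>.2 ⟨Q, ?_, ?_⟩)
        · intro P hP
          rw [Finset.mem_filter] at hP ⊢
          by_cases hPU : P ∈ U
          · exact ⟨hP.1, hU P hPU⟩
          · simpa [Interp.assign, hPU] using hP
        · exact Finset.mem_filter.2 ⟨hun Q (hU Q hQU), hU Q hQU⟩
        · rw [Finset.mem_filter]
          simp [Interp.assign, hQU, hv]
      · intro P h
        by_cases hPU : P ∈ U
        · simp [Interp.assign, hPU, hUI P hPU]
        · simp only [Interp.assign, hPU, if_false] at h ⊢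
          exact hWI P h
      · intro P h
        by_cases hPU : P ∈ U
        · exact hun P (hU P hPU)
        · simp only [Interp.assign, hPU, if_false] at h
          exact hun P h
    by_cases hterm : ∀ J, ¬ D.Step W J
    · by_cases htwo : ∃ P, W P = .un
      · obtain ⟨P, hP⟩ := htwo
        exact refutes_of_terminal hD hWI hun hterm hP
      -- A terminal `W` without unknown atoms is `I` itself, which would make `D` true in `I`.
      · have : W = I := funext fun P => hWI P fun h => htwo ⟨P, h⟩
        subst this
        exact (hDI ⟨hI, hreach, hterm⟩).elim
    · push Not at hterm
      obtain ⟨J, hJ⟩ := hterm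
      cases hJ with
      | derive_true P φ hP hr hφ =>
        by_cases hIP : I P = .tr
        · exact next {P} .tr (by simp) ⟨P, rfl⟩ (by simpa using hP)
            (.derive_true W P φ hP hr hφ) (by simpa using hIP)
        · exact refutes_of_derive_true hD hWI hr hφ hIP
      | derive_false U hne hU hφ =>
        by_cases hIU : ∀ P ∈ U, I P = .fa
        · exact next U .fa (by simp) hne (fun P hP => (hU P hP).2)
            (.derive_false W U hne hU hφ) hIU
        · push Not at hIU
          obtain ⟨P, hPU, hIP⟩ := hIU
          obtain ⟨⟨P', φ⟩, hr, rfl⟩ := Finset.mem_image.1 (hU P hPU).1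
          refine refutes_of_derive_false hD hWI (fun P hP => (hU P hP).1) hφ hPU
            (hD _ _ hr).1 ?_
          have := hI P'
          cases hv : I P' <;> simp_all

end Refute

/-! ### Assembling the completeness proof -/

/-- In a two-valued interpretation "not false" and "true" coincide, so the lower and upper
evaluations agree and the literals decide the formula. -/
theorem PCFormula.proves_or_refutes {α : Type u} {I : Interp α} {S : Finset α}
    (φ : PCFormula α) (hS : φ.atoms ⊆ S) (hI : I.TwoValued) :
    (φ.val I = .tr → Proves (literals I S) φ.toFormula) ∧
      (φ.val I ≠ .tr → Refutes (literals I S) φ.toFormula) := by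
  have hfa : ∀ P, I P ≠ .fa → I P = .tr := fun P h => by
    have := hI P
    cases hv : I P <;> simp_all
  have h := φ.proves_and_refutes (literals I S) id id (fun P => I P = .tr) (fun P => I P ≠ .fa)
  rw [PCFormula.subst_id] at h
  rw [Ne, (φ.val_eq_iff_holds I).1]
  refine ⟨h.1 (fun P hP h => atom_mem_literals (hS hP) h) fun P hP h => ?_,
    h.2 (fun P hP h => neg_atom_mem_literals (hS hP) h)
      fun P hP h => atom_mem_literals (hS hP) (hfa P h)⟩
  exact neg_atom_mem_literals (hS hP) (by simp [not_not.1 h])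

/-- Finitely many atoms contain the vocabulary of a definition and of a finite set of formulas. -/
theorem exists_vocabulary {α : Type u} (D : Definition α) (Γ : Finset (PCFormula α)) :
    ∃ S : Finset α, (∀ P φ, (P, φ) ∈ D.rules → P ∈ S ∧ φ.atoms ⊆ S) ∧
      ∀ φ ∈ Γ, φ.atoms ⊆ S := by
  have h₁ : (⋃ r ∈ D.rules, insert r.1 r.2.atoms).Finite :=
    D.rules.finite_toSet.biUnion fun r _ => r.2.atoms_finite.insert _
  have h₂ : (⋃ φ ∈ Γ, φ.atoms).Finite :=
    Γ.finite_toSet.biUnion fun φ _ => φ.atoms_finite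
  refine ⟨(h₁.union h₂).toFinset, fun P φ hr => ?_, fun φ hφ => ?_⟩
  · rw [Set.Finite.coe_toFinset, Set.Finite.mem_toFinset]
    have hsub := Set.subset_biUnion_of_mem (u := fun r : α × PCFormula α => insert r.1 r.2.atoms) hr
    exact ⟨.inl (hsub (Set.mem_insert _ _)), fun Q hQ => .inl (hsub (Set.mem_insert_of_mem _ hQ))⟩
  · rw [Set.Finite.coe_toFinset]
    exact fun Q hQ => .inr (Set.mem_biUnion (t := PCFormula.atoms) hφ hQ)

end PCID

theorem mainTheorem3 {α : Type*} (D : PCID.Definition α) (Γ Δ : Finset (PCID.PCFormula α))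
    (h : PCID.Valid (insert (PCID.Formula.defn D) (Γ.image PCID.PCFormula.toFormula))
      (Δ.image PCID.PCFormula.toFormula)) :
    PCID.Provable (insert (PCID.Formula.defn D) (Γ.image PCID.PCFormula.toFormula))
      (Δ.image PCID.PCFormula.toFormula) := by
  classical
  obtain ⟨S, hD, hS⟩ := PCID.exists_vocabulary D (Γ ∪ Δ)
  refine PCID.Provable.of_forall_literals S fun I hI => ?_
  by_cases hΓ : ∀ A ∈ Γ, A.val I = .tr
  · by_cases hΔ : ∃ B ∈ Δ, B.val I = .tr
    · obtain ⟨B, hB, hBI⟩ := hΔ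
      have hp := (B.proves_or_refutes (hS B (Finset.mem_union_right _ hB)) hI).1 hBI
      exact hp.mono Finset.subset_union_left
        (Finset.singleton_subset_iff.2 (Finset.mem_image_of_mem _ hB))
    -- The only place where validity is used: `I` satisfies `Γ` and no formula of `Δ`, so `D` must
    -- be false in it.
    · have hDI : ¬ D.Holds I := by
        intro hDI
        obtain ⟨B, hB, hBI⟩ := h I hI (by
          intro A hA
          rcases Finset.mem_insert.1 hA with rfl | hA
          · exact ⟨hI, by simp [PCID.Formula.val, hDI]⟩
          · obtain ⟨φ, hφ, rfl⟩ := Finset.mem_image.1 hA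
            exact ⟨hI, by rw [PCID.PCFormula.val_toFormula, hΓ φ hφ]⟩)
        obtain ⟨φ, hφ, rfl⟩ := Finset.mem_image.1 hB
        exact hΔ ⟨φ, hφ, by rw [← PCID.PCFormula.val_toFormula, hBI.2]⟩
      refine (PCID.refutes_of_not_holds hD hI hDI).mono ?_ (Finset.empty_subset _)
      intro A
      simp only [Finset.mem_insert, Finset.mem_union]
      tauto
  · push Not at hΓ
    obtain ⟨A, hA, hAI⟩ := hΓ
    have hr := (A.proves_or_refutes (hS A (Finset.mem_union_left _ hA)) hI).2 hAI
    refine hr.mono (Finset.insert_subset ?_ Finset.subset_union_left) (Finset.empty_subset _)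
    exact Finset.mem_union_right _ (Finset.mem_insert_of_mem (Finset.mem_image_of_mem _ hA))
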